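/- Write $\mathbb D$ for the open unit disc of $\mathbb C$. For a domain $D\subset\mathbb C^n$ and $z,w\in D$ let $$\tilde k_D(z,w)=\inf\{\tanh^{-1}|\alpha| : \alpha\in\mathbb D,\ \exists\,\varphi:\mathbb D\to D \text{ holomorphic},\ \varphi(0)=z,\ \varphi(\alpha)=w\}$$ be the Lempert function of $D$, and for $m\in\mathbb N$ let $$k_D^{(m)}(z,w)=\inf\Big\{\sum_{j=1}^m\tilde k_D(z_{j-1},z_j) : z_0,\dots,z_m\in D,\ z_0=z,\ z_m=w\Big\}$$ be the $m$-th Lempert function of $D$. A boundary point $b$ of $D$ is called a local weak barrier point if there are a neighborhood $U$ of $b$ and a negative plurisubharmonic function $u$ on $D\cap U$ such that $\lim_{D\ni z\to b}u(z)=0$. Let $b$ be a local weak barrier point of a bounded domain $D\subset\mathbb C^n$, and suppose that $\partial D$ contains no nontrivial analytic disc through $b$, i.e. there is no nonconstant holomorphic map $\varphi:\mathbb D\to\mathbb C^n$ with $\varphi(\mathbb D)\subset\partial D$ and $b\in\varphi(\mathbb D)$. Then for every $z\in D$ and every $m\in\mathbb N$, $$\lim_{D\ni w\to b}k_D^{(m)}(z,w)=\infty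 .$$ -/

import Mathlib

open Filter Topology Metric MeasureTheory
open scoped ENNReal

noncomputable section

namespace LempertFn

/-- `ℂⁿ` with its Euclidean norm. -/
abbrev Cn (n : ℕ) : Type := EuclideanSpace ℂ (Fin n)

/-- A domain of `ℂⁿ`: a nonempty connected open set. -/
def IsDomainOf {n : ℕ} (D : Set (Cn n)) : Prop :=
  IsOpen D ∧ IsConnected D

/-- The open unit disc of `ℂ`. -/
abbrev disc : Set ℂ := ball (0 : ℂ) 1

/-- `φ ∈ 𝒪(𝔻, S)`: the map `φ` is holomorphic on the unit disc and takes its values there in `S`. -/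
def IsDiscIn {n : ℕ} (φ : ℂ → Cn n) (S : Set (Cn n)) : Prop :=
  DifferentiableOn ℂ φ disc ∧ Set.MapsTo φ disc S

/-- The Lempert function of `D`, with values in `[0, ∞]` (the infimum over the empty set is `∞`). -/
def lempert {n : ℕ} (D : Set (Cn n)) (z w : Cn n) : ℝ≥0∞ :=
  ⨅ (α : ℂ) (_ : α ∈ disc)
    (_ : ∃ φ : ℂ → Cn n, IsDiscIn φ D ∧ φ 0 = z ∧ φ α = w),
    ENNReal.ofReal (Real.artanh ‖α‖)

/-- The `m`-th Lempert function of `D`: the infimum of the sums of Lempert functions along chains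
`z = p 0, p 1, …, p m = w` in `D`. -/
def lempertChain {n : ℕ} (D : Set (Cn n)) (m : ℕ) (z w : Cn n) : ℝ≥0∞ :=
  ⨅ (p : Fin (m + 1) → Cn n) (_ : ∀ j, p j ∈ D) (_ : p 0 = z) (_ : p (Fin.last m) = w),
    ∑ j : Fin m, lempert D (p j.castSucc) (p j.succ)

/-- The mean value over `[0, 2π]` of a function with values in `[-∞, ∞]`: the mean of the positive
part minus the mean of the negative part. (For a function bounded above, the first mean is finite,
so that the difference is meaningful.) -/
def angularMean (g : ℝ → EReal) : EReal :=
  ((⨍⁻ θ in Set.Ioc 0 (2 * Real.pi), (g θ).toENNReal ∂volume : ℝ≥0∞) : EReal) -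
    ((⨍⁻ θ in Set.Ioc 0 (2 * Real.pi), (-(g θ)).toENNReal ∂volume : ℝ≥0∞) : EReal)

/-- A function `u`, with values in `[-∞, ∞)`, is plurisubharmonic on the open set `Ω`: it is upper
semicontinuous there and satisfies the sub-mean value inequality on every closed disc of a complex
line that is contained in `Ω`. Only the values of `u` on `Ω` matter. -/
def PlurisubharmonicOn {n : ℕ} (u : Cn n → EReal) (Ω : Set (Cn n)) : Prop :=
  UpperSemicontinuousOn u Ω ∧
  (∀ z ∈ Ω, u z < ⊤) ∧
  ∀ a v : Cn n, (∀ ζ ∈ closedBall (0 : ℂ) 1, a + ζ • v ∈ Ω) →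
    u a ≤ angularMean fun θ : ℝ => u (a + Complex.exp (θ * Complex.I) • v)

/-- `b` is a local weak barrier point of `D`: a boundary point with an open neighbourhood `U` and a
negative plurisubharmonic function `u` on `D ∩ U` that tends to `0` at `b`. -/
def IsLocalWeakBarrierPoint {n : ℕ} (D : Set (Cn n)) (b : Cn n) : Prop :=
  b ∈ frontier D ∧
  ∃ U : Set (Cn n), IsOpen U ∧ b ∈ U ∧
    ∃ u : Cn n → EReal, PlurisubharmonicOn u (D ∩ U) ∧ (∀ z ∈ D ∩ U, u z < 0) ∧
      Tendsto u (𝓝[D ∩ U] b) (𝓝 0)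

/-- The set `S` contains a nontrivial analytic disc through `b`: a nonconstant holomorphic map of
the unit disc into `S` with `b` in its image. -/
def HasNontrivialDiscThrough {n : ℕ} (S : Set (Cn n)) (b : Cn n) : Prop :=
  ∃ φ : ℂ → Cn n, IsDiscIn φ S ∧ b ∈ φ '' disc ∧ ∃ ζ ∈ disc, φ ζ ≠ b

end LempertFn

end

namespace LempertFn

/-! If a chain of bounded length ends near `b`, each of its points is near `b`, so it cannot start
at the fixed point `z`. By induction this reduces to one link (`eventually_mem_of_lempert_lt`).
Suppose discs `φ k` in `D` satisfy `φ k (α k) → b` with the `α k` in a fixed compact part of the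
unit disc. A Montel limit `ψ` takes the value `b` at `a = lim α k`. If `ψ` maps a neighbourhood of
`a` into `∂D`, the hypothesis on discs makes it constant there, hence everywhere, and so `φ k 0 →
b`.

That `ψ` is locally in `∂D` is where the barrier enters (`limit_disc_mem_frontier`). If `ψ ζ₁ ∈ D`
with `ζ₁` near `a`, then `g = -u` exceeds some `c > 0` near `ψ ζ₁`, hence along `φ k` on an arc of
fixed angular size of a circle about `α k`. The minimum principle bounds `g (φ k (α k))` below
uniformly, against `g → 0` at `b`.

Plurisubharmonicity is tested on affine discs only, so the minimum principle along curved discs is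
itself proved, by a penalisation argument. -/

/-! ### Plurisuperharmonic functions and mean values -/

/-- A function with values in `[0, ∞]` that is lower semicontinuous on `Ω` and satisfies the
super-mean value inequality on every closed disc of a complex line contained in `Ω`. -/
structure PlurisuperharmonicOn {n : ℕ} (g : Cn n → ℝ≥0∞) (Ω : Set (Cn n)) : Prop where
  lsc : LowerSemicontinuousOn g Ω
  laverage_le : ∀ a v : Cn n, (∀ ζ ∈ closedBall (0 : ℂ) 1, a + ζ • v ∈ Ω) →
    ⨍⁻ θ in Set.Ioc 0 (2 * Real.pi), g (a + Complex.exp ((θ : ℝ) * Complex.I) • v) ∂volume ≤ g a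

/-- Since `u < 0`, the positive-part mean in `angularMean` vanishes, so no `∞ - ∞` arises and the
inequality passes to a lower integral in `[0, ∞]`. -/
lemma PlurisubharmonicOn.neg {n : ℕ} {u : Cn n → EReal} {Ω : Set (Cn n)}
    (hu : PlurisubharmonicOn u Ω) (hneg : ∀ z ∈ Ω, u z < 0) :
    PlurisuperharmonicOn (fun z => (-(u z)).toENNReal) Ω := by
  obtain ⟨husc, -, hmean⟩ := hu
  refine ⟨?_, fun a v hav => ?_⟩
  · intro z hz y hy
    have h1 : u z < -(y : EReal) := by
      rw [EReal.lt_neg_comm]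
      by_contra! hcon
      have h2 := EReal.toENNReal_le_toENNReal hcon
      rw [EReal.toENNReal_coe] at h2
      exact absurd hy (not_lt.2 h2)
    filter_upwards [husc z hz _ h1] with w hw
    rw [EReal.lt_neg_comm] at hw
    by_contra! hcon
    exact absurd hw (not_lt.2 ((EReal.coe_toENNReal_eq_max.symm ▸ le_max_right 0 _).trans
      (EReal.coe_ennreal_le_coe_ennreal_iff.2 hcon)))
  · have hmem : ∀ θ : ℝ, a + Complex.exp (θ * Complex.I) • v ∈ Ω := fun θ =>
      hav _ (by simp [Complex.norm_exp_ofReal_mul_I])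
    have h := hmean a v hav
    have h0 : ∀ θ : ℝ, (u (a + Complex.exp (θ * Complex.I) • v)).toENNReal = 0 := fun θ =>
      EReal.toENNReal_of_nonpos (hneg _ (hmem θ)).le
    simp only [angularMean, h0, laverage_zero, EReal.coe_ennreal_zero, zero_sub] at h
    have h2 := EReal.le_neg_of_le_neg h
    have h3 := EReal.toENNReal_le_toENNReal h2
    simpa using h3

lemma ofReal_average_le_laverage {f : ℝ → ℝ} (hf : Continuous f) :
    ENNReal.ofReal ((2 * Real.pi)⁻¹ * ∫ θ in 0..2 * Real.pi, f θ) ≤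
      ⨍⁻ θ in Set.Ioc 0 (2 * Real.pi), ENNReal.ofReal (f θ) ∂volume := by
  have hpi : (0 : ℝ) < 2 * Real.pi := by positivity
  rw [setLAverage_eq, Real.volume_Ioc, sub_zero, ENNReal.div_eq_inv_mul,
    ENNReal.ofReal_mul (by positivity), ENNReal.ofReal_inv_of_pos hpi]
  gcongr
  rw [intervalIntegral.integral_of_le hpi.le]
  have hint : IntegrableOn f (Set.Ioc 0 (2 * Real.pi)) := hf.integrableOn_Ioc
  have hint' : IntegrableOn (fun θ => max (f θ) 0) (Set.Ioc 0 (2 * Real.pi)) :=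
    (hf.max continuous_const).integrableOn_Ioc
  calc ENNReal.ofReal (∫ θ in Set.Ioc 0 (2 * Real.pi), f θ)
      ≤ ENNReal.ofReal (∫ θ in Set.Ioc 0 (2 * Real.pi), max (f θ) 0) :=
        ENNReal.ofReal_le_ofReal (integral_mono hint hint' fun θ => le_max_left _ _)
    _ = ∫⁻ θ in Set.Ioc 0 (2 * Real.pi), ENNReal.ofReal (max (f θ) 0) :=
        ofReal_integral_eq_lintegral_ofReal hint' (ae_of_all _ fun θ => le_max_right _ _)
    _ = ∫⁻ θ in Set.Ioc 0 (2 * Real.pi), ENNReal.ofReal (f θ) := by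
        simp [ENNReal.ofReal_max]

lemma integral_re_circleMap {H : ℂ → ℂ} {r : ℝ} (hr : 0 < r)
    (hH : DifferentiableOn ℂ H (closedBall 0 r)) :
    ∫ θ in 0..2 * Real.pi, (H (circleMap 0 r θ)).re = 2 * Real.pi * (H 0).re := by
  have h : Real.circleAverage H 0 r = H 0 := by
    apply DiffContOnCl.circleAverage
    rw [abs_of_pos hr]
    refine ⟨hH.mono ball_subset_closedBall, ?_⟩
    rw [closure_ball _ hr.ne']
    exact hH.continuousOn
  have hint : IntervalIntegrable (fun θ => H (circleMap 0 r θ)) volume 0 (2 * Real.pi) := by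
    apply Continuous.intervalIntegrable
    exact hH.continuousOn.comp_continuous (continuous_circleMap 0 r)
      fun θ => sphere_subset_closedBall (circleMap_mem_sphere 0 hr.le θ)
  rw [Real.circleAverage_def] at h
  have h2 : ∫ θ in 0..2 * Real.pi, (H (circleMap 0 r θ)).re =
      (∫ θ in 0..2 * Real.pi, H (circleMap 0 r θ)).re := by
    have := Complex.reCLM.intervalIntegral_comp_comm hint
    simpa using this
  rw [h2, ← h]
  have hpi : (2 * Real.pi) ≠ 0 := by positivity
  rw [Complex.smul_re, smul_eq_mul, ← mul_assoc, mul_inv_cancel₀ hpi, one_mul]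

/-- A plurisuperharmonic function cannot, to second order, exceed its value at the centre of an
affine disc. -/
lemma PlurisuperharmonicOn.not_strict_min {n : ℕ} {g : Cn n → ℝ≥0∞} {Ω : Set (Cn n)}
    (hg : PlurisuperharmonicOn g Ω) {a v : Cn n} {r : ℝ} (hr : 0 < r)
    (hav : ∀ τ ∈ closedBall (0 : ℂ) r, a + τ • v ∈ Ω) (ha : g a ≠ ⊤) {H : ℂ → ℂ}
    (hH : DifferentiableOn ℂ H (closedBall 0 r)) {ε : ℝ} (hε : 0 < (H 0).re + ε)
    (hle : ∀ τ ∈ sphere (0 : ℂ) r,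
      ENNReal.ofReal ((g a).toReal + ε + (H τ).re) ≤ g (a + τ • v)) : False := by
  have h1 := hg.laverage_le a ((r : ℂ) • v) fun ζ hζ => by
    rw [smul_smul]
    apply hav
    rw [mem_closedBall_zero_iff] at hζ ⊢
    rw [norm_mul, Complex.norm_real, Real.norm_eq_abs, abs_of_pos hr]
    nlinarith
  have hcont : Continuous fun θ : ℝ => (g a).toReal + ε + (H (circleMap 0 r θ)).re :=
    continuous_const.add (Complex.continuous_re.comp
      (hH.continuousOn.comp_continuous (continuous_circleMap 0 r)
        fun θ => sphere_subset_closedBall (circleMap_mem_sphere 0 hr.le θ)))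
  have h2 := ofReal_average_le_laverage hcont
  have hcont' : Continuous fun θ : ℝ => (H (circleMap 0 r θ)).re :=
    Complex.continuous_re.comp
      (hH.continuousOn.comp_continuous (continuous_circleMap 0 r)
        fun θ => sphere_subset_closedBall (circleMap_mem_sphere 0 hr.le θ))
  have hpi : (2 * Real.pi) ≠ 0 := by positivity
  have h3 : (2 * Real.pi)⁻¹ * ∫ θ in 0..2 * Real.pi,
      ((g a).toReal + ε + (H (circleMap 0 r θ)).re) = (g a).toReal + ε + (H 0).re := by
    rw [intervalIntegral.integral_add intervalIntegrable_const (hcont'.intervalIntegrable _ _),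
      integral_re_circleMap hr hH, intervalIntegral.integral_const]
    simp only [sub_zero, smul_eq_mul]
    field_simp
  rw [h3] at h2
  have h4 : ⨍⁻ θ in Set.Ioc 0 (2 * Real.pi),
      ENNReal.ofReal ((g a).toReal + ε + (H (circleMap 0 r θ)).re) ∂volume ≤
      ⨍⁻ θ in Set.Ioc 0 (2 * Real.pi),
        g (a + Complex.exp ((θ : ℝ) * Complex.I) • (r : ℂ) • v) ∂volume := by
    apply laverage_mono_ae
    refine ae_of_all _ fun θ => (hle _ (circleMap_mem_sphere 0 hr.le θ)).trans (le_of_eq ?_)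
    simp only [circleMap, zero_add, smul_smul]
    rw [mul_comm]
  have h5 := (h2.trans h4).trans h1
  rw [ENNReal.ofReal_le_iff_le_toReal ha] at h5
  linarith

/-! ### Minimum principle along analytic discs -/

/-- Semicontinuity and compactness let the strict boundary inequality survive small translations of
the disc. The alternative `p ζ < 0` is needed because `ENNReal.ofReal` truncates at `0`, which need
not lie strictly below `g`. -/
lemma eventually_forall_sphere_lt {n : ℕ} {g : Cn n → ℝ≥0∞} {Ω : Set (Cn n)} (hΩ : IsOpen Ω)
    (hg : LowerSemicontinuousOn g Ω) {W K : Set ℂ} (hW : IsOpen W) (hK : IsCompact K)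
    (hKW : K ⊆ W) {φ : ℂ → Cn n} (hφ : ContinuousOn φ W) (hφΩ : Set.MapsTo φ K Ω)
    {p : ℂ → ℝ} (hp : ContinuousOn p W)
    (hlt : ∀ ζ ∈ K, p ζ < 0 ∨ ENNReal.ofReal (p ζ) < g (φ ζ)) :
    ∀ᶠ h : Cn n in 𝓝 0, ∀ ζ ∈ K, p ζ < 0 ∨ ENNReal.ofReal (p ζ) < g (φ ζ + h) := by
  apply hK.eventually_forall_of_forall_eventually
  intro ζ hζ
  have hWn := hW.mem_nhds (hKW hζ)
  have hpc : Tendsto (fun x : Cn n × ℂ => p x.2) (𝓝 (0, ζ)) (𝓝 (p ζ)) :=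
    (hp.continuousAt hWn).tendsto.comp continuousAt_snd
  rcases hlt ζ hζ with h | h
  · filter_upwards [hpc.eventually (gt_mem_nhds h)] with x hx using Or.inl hx
  · obtain ⟨c, hc1, hc2⟩ := exists_between h
    have hφc : Tendsto (fun x : Cn n × ℂ => φ x.2 + x.1) (𝓝 (0, ζ)) (𝓝 (φ ζ)) := by
      have h1 : Tendsto (fun x : Cn n × ℂ => φ x.2) (𝓝 (0, ζ)) (𝓝 (φ ζ)) :=
        (hφ.continuousAt hWn).tendsto.comp continuousAt_snd
      simpa using h1.add continuousAt_fst
    have hgc : ∀ᶠ z in 𝓝 (φ ζ), c < g z := by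
      have := hg (φ ζ) (hφΩ hζ) c hc2
      rwa [(hΩ.nhdsWithin_eq (hφΩ hζ))] at this
    have hpc' := (ENNReal.tendsto_ofReal hpc).eventually (gt_mem_nhds hc1)
    filter_upwards [hφc.eventually hgc, hpc'] with x hx hx' using Or.inr (hx'.trans hx)

lemma eventually_forall_add_mem {n : ℕ} {Ω : Set (Cn n)} (hΩ : IsOpen Ω)
    {W K : Set ℂ} (hW : IsOpen W) (hK : IsCompact K)
    (hKW : K ⊆ W) {φ : ℂ → Cn n} (hφ : ContinuousOn φ W) (hφΩ : Set.MapsTo φ K Ω) :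
    ∀ᶠ h : Cn n in 𝓝 0, ∀ ζ ∈ K, φ ζ + h ∈ Ω := by
  apply hK.eventually_forall_of_forall_eventually
  intro ζ hζ
  have hφc : Tendsto (fun x : Cn n × ℂ => φ x.2 + x.1) (𝓝 (0, ζ)) (𝓝 (φ ζ)) := by
    have h1 : Tendsto (fun x : Cn n × ℂ => φ x.2) (𝓝 (0, ζ)) (𝓝 (φ ζ)) :=
      (hφ.continuousAt (hW.mem_nhds (hKW hζ))).tendsto.comp continuousAt_snd
    simpa using h1.add continuousAt_fst
  exact hφc.eventually (hΩ.mem_nhds (hφΩ hζ))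

/-- No interior minimum of a plurisuperharmonic function along a thickened analytic disc, once
penalised by a strictly subharmonic function of the parameter and the squared distance to the
disc. -/
lemma PlurisuperharmonicOn.no_penalised_min {n : ℕ} {g : Cn n → ℝ≥0∞} {Ω : Set (Cn n)}
    (hg : PlurisuperharmonicOn g Ω) {φ : ℂ → Cn n} {P : ℂ → ℂ}
    (hφ : DifferentiableOn ℂ φ (ball 0 1)) (hP : DifferentiableOn ℂ P (ball 0 1))
    {M δ lam ρ : ℝ} (hδ : 0 < δ) (hlam : 0 < lam)
    (hmem : ∀ h ∈ closedBall (0 : Cn n) ρ, ∀ ζ ∈ closedBall (0 : ℂ) 1, φ ζ + h ∈ Ω)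
    {T : Cn n × ℂ → ℝ} (hT : T = fun x => M - (P x.2).re + δ - δ * ‖x.2‖ ^ 2 + lam * ‖x.1‖ ^ 2)
    {h₀ : Cn n} {ζ₀ : ℂ} (hh₀ : h₀ ∈ ball (0 : Cn n) ρ) (hζ₀ : ζ₀ ∈ ball (0 : ℂ) 1)
    (hfin : g (φ ζ₀ + h₀) ≠ ⊤)
    (hTnn : ∀ x ∈ closedBall (0 : Cn n) ρ ×ˢ closedBall (0 : ℂ) 1, 0 ≤ T x)
    (hmin : IsMinOn (fun x : Cn n × ℂ => g (φ x.2 + x.1) + ENNReal.ofReal (T x))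
      (closedBall 0 ρ ×ˢ closedBall 0 1) (h₀, ζ₀)) : False := by
  rw [mem_ball_zero_iff] at hh₀ hζ₀
  set d := deriv φ ζ₀ with hd
  have hderiv : HasDerivAt φ d ζ₀ :=
    (hφ.differentiableAt (isOpen_ball.mem_nhds (mem_ball_zero_iff.2 hζ₀))).hasDerivAt
  set R : ℂ → Cn n := fun τ => φ (ζ₀ + τ) - φ ζ₀ - τ • d with hR
  -- The first bound on `κ` lets half of the gain `δ * r ^ 2` absorb the quadratic error `lam * ‖R
  -- τ‖ ^ 2`; the second keeps `h₀ - R τ` within radius `ρ`.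
  obtain ⟨κ, hκ0, hκ1, hκ2⟩ : ∃ κ > 0, lam * κ ^ 2 ≤ δ / 2 ∧ κ ≤ ρ - ‖h₀‖ := by
    refine ⟨min (Real.sqrt (δ / 2 / lam)) (ρ - ‖h₀‖), lt_min (by positivity) (by linarith), ?_,
      min_le_right _ _⟩
    have h1 : min (Real.sqrt (δ / 2 / lam)) (ρ - ‖h₀‖) ^ 2 ≤ Real.sqrt (δ / 2 / lam) ^ 2 :=
      pow_le_pow_left₀ (le_min (by positivity) (by linarith)) (min_le_left _ _) 2
    rw [Real.sq_sqrt (by positivity)] at h1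
    calc lam * _ ≤ lam * (δ / 2 / lam) := by gcongr
      _ = δ / 2 := by field_simp
  have hRo : ∀ᶠ τ in 𝓝 (0 : ℂ), ‖R τ‖ ≤ κ * ‖τ‖ :=
    (hasDerivAt_iff_isLittleO_nhds_zero.1 hderiv).def hκ0
  obtain ⟨r₁, hr₁, hRr⟩ := Metric.eventually_nhds_iff_ball.1 hRo
  obtain ⟨r, hr0, hr1, hr2, hr3⟩ : ∃ r > 0, r < r₁ ∧ r ≤ 1 ∧ r < 1 - ‖ζ₀‖ := by
    have : 0 < min r₁ (min 1 (1 - ‖ζ₀‖)) := lt_min hr₁ (lt_min one_pos (by linarith))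
    refine ⟨min r₁ (min 1 (1 - ‖ζ₀‖)) / 2, by positivity, ?_, ?_, ?_⟩
    · linarith [min_le_left r₁ (min 1 (1 - ‖ζ₀‖))]
    · linarith [min_le_right r₁ (min 1 (1 - ‖ζ₀‖)), min_le_left 1 (1 - ‖ζ₀‖)]
    · linarith [min_le_right r₁ (min 1 (1 - ‖ζ₀‖)), min_le_right 1 (1 - ‖ζ₀‖)]
  have hRle : ∀ τ ∈ closedBall (0 : ℂ) r, ‖R τ‖ ≤ κ * ‖τ‖ := fun τ hτ =>
    hRr τ (closedBall_subset_ball hr1 hτ)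
  have hmaps : Set.MapsTo (fun τ => ζ₀ + τ) (closedBall (0 : ℂ) r) (ball 0 1) := fun τ hτ => by
    rw [mem_closedBall_zero_iff] at hτ
    rw [mem_ball_zero_iff]
    linarith [norm_add_le ζ₀ τ]
  have hin : ∀ τ ∈ closedBall (0 : ℂ) r,
      (h₀ - R τ, ζ₀ + τ) ∈ closedBall (0 : Cn n) ρ ×ˢ closedBall (0 : ℂ) 1 := fun τ hτ => by
    refine ⟨?_, ball_subset_closedBall (hmaps hτ)⟩
    have h1 := hRle τ hτ
    rw [mem_closedBall_zero_iff] at hτ ⊢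
    have h2 : κ * ‖τ‖ ≤ κ * 1 := by gcongr; linarith
    linarith [norm_sub_le h₀ (R τ)]
  -- The thickening variable `h` absorbs the Taylor remainder, so the tangent affine disc stays in
  -- the family over which the minimum is taken.
  have heq : ∀ τ, φ ζ₀ + h₀ + τ • d = φ (ζ₀ + τ) + (h₀ - R τ) := fun τ => by
    simp only [hR]; abel
  -- `-(H τ).re` collects the harmonic part of the change in `T`. `H` is holomorphic because
  -- conjugation falls only on the constants `ζ₀` and `h₀`.
  set H : ℂ → ℂ := fun τ => (P (ζ₀ + τ) - P ζ₀) + (2 * δ : ℂ) * (starRingEnd ℂ ζ₀) * τ +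
    (2 * lam : ℂ) * (innerSL ℂ h₀ (R τ)) with hH
  have hshift : ∀ {E : Type} [NormedAddCommGroup E] [NormedSpace ℂ E] {f : ℂ → E},
      DifferentiableOn ℂ f (ball 0 1) →
      DifferentiableOn ℂ (fun τ => f (ζ₀ + τ)) (closedBall 0 r) := fun hf =>
    hf.comp (by fun_prop) hmaps
  have hRd : DifferentiableOn ℂ R (closedBall 0 r) := by
    have := hshift hφ
    simp only [hR]
    fun_prop
  have hHd : DifferentiableOn ℂ H (closedBall 0 r) := by
    have h1 := hshift hP
    have h2 : DifferentiableOn ℂ (fun τ => innerSL ℂ h₀ (R τ)) (closedBall 0 r) :=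
      (innerSL ℂ h₀).differentiable.comp_differentiableOn hRd
    simp only [hH]
    fun_prop
  have hR0 : R 0 = 0 := by simp [hR]
  have hH0 : H 0 = 0 := by simp [hH, hR0]
  refine hg.not_strict_min (a := φ ζ₀ + h₀) (v := d) hr0 (fun τ hτ => ?_) hfin hHd
    (ε := δ / 2 * r ^ 2) (by rw [hH0, Complex.zero_re]; positivity) fun τ hτ => ?_
  · rw [heq]
    exact hmem _ (hin τ hτ).1 _ (hin τ hτ).2
  · have hτ' := sphere_subset_closedBall hτ
    have hmin' := isMinOn_iff.1 hmin _ (hin τ hτ')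
    simp only [← heq] at hmin'
    have hTle : T (h₀ - R τ, ζ₀ + τ) ≤ T (h₀, ζ₀) - δ / 2 * r ^ 2 - (H τ).re := by
      have h1 := hRle τ hτ'
      rw [mem_sphere_zero_iff_norm] at hτ
      rw [hτ] at h1
      have h2 : lam * ‖R τ‖ ^ 2 ≤ δ / 2 * r ^ 2 := by
        calc lam * ‖R τ‖ ^ 2 ≤ lam * (κ * r) ^ 2 := by gcongr
          _ = (lam * κ ^ 2) * r ^ 2 := by ring
          _ ≤ δ / 2 * r ^ 2 := by gcongr
      have h3 : ‖h₀ - R τ‖ ^ 2 = ‖h₀‖ ^ 2 - 2 * (innerSL ℂ h₀ (R τ)).re + ‖R τ‖ ^ 2 := by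
        have := norm_sub_sq (𝕜 := ℂ) h₀ (R τ)
        simpa using this
      have h4 : ‖ζ₀ + τ‖ ^ 2 = ‖ζ₀‖ ^ 2 + 2 * (starRingEnd ℂ ζ₀ * τ).re + r ^ 2 := by
        rw [← hτ, Complex.sq_norm, Complex.sq_norm, Complex.sq_norm, Complex.normSq_add]
        simp
        ring
      have h5 : (H τ).re = (P (ζ₀ + τ)).re - (P ζ₀).re + 2 * δ * (starRingEnd ℂ ζ₀ * τ).re +
          2 * lam * (innerSL ℂ h₀ (R τ)).re := by
        have e1 : (2 * δ : ℂ) * (starRingEnd ℂ ζ₀) * τ =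
          ((2 * δ : ℝ) : ℂ) * ((starRingEnd ℂ ζ₀) * τ) := by push_cast; ring
        have e2 : (2 * lam : ℂ) = ((2 * lam : ℝ) : ℂ) := by push_cast; ring
        simp only [hH]
        rw [e1, e2, Complex.add_re, Complex.add_re, Complex.re_ofReal_mul, Complex.re_ofReal_mul,
          Complex.sub_re]
      simp only [hT, h3, h4, h5]
      linarith
    have hx : g (φ ζ₀ + h₀) = ENNReal.ofReal (g (φ ζ₀ + h₀)).toReal :=
      (ENNReal.ofReal_toReal hfin).symm
    have hT0 := hTnn (h₀, ζ₀)
      ⟨mem_closedBall_zero_iff.2 hh₀.le, mem_closedBall_zero_iff.2 hζ₀.le⟩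
    rw [hx, ← ENNReal.ofReal_add ENNReal.toReal_nonneg hT0] at hmin'
    rcases le_total ((g (φ ζ₀ + h₀)).toReal + δ / 2 * r ^ 2 + (H τ).re) 0 with hneg | hpos
    · rw [ENNReal.ofReal_of_nonpos hneg]
      exact zero_le
    refine (ENNReal.add_le_add_iff_right
      (ENNReal.ofReal_ne_top (r := T (h₀ - R τ, ζ₀ + τ)))).1 (le_trans ?_ hmin')
    rw [← ENNReal.ofReal_add hpos (hTnn _ (hin τ hτ'))]
    exact ENNReal.ofReal_le_ofReal (by linarith)

/-- The minimum principle for a plurisuperharmonic function along an analytic disc, with harmonic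
comparison functions. -/
theorem PlurisuperharmonicOn.le_of_lt_on_sphere {n : ℕ} {g : Cn n → ℝ≥0∞} {Ω : Set (Cn n)}
    (hΩ : IsOpen Ω) (hg : PlurisuperharmonicOn g Ω) {W : Set ℂ} (hW : IsOpen W)
    (hKW : closedBall (0 : ℂ) 1 ⊆ W) {φ : ℂ → Cn n} {P : ℂ → ℂ} (hφ : DifferentiableOn ℂ φ W)
    (hP : DifferentiableOn ℂ P W) (hφΩ : Set.MapsTo φ (closedBall 0 1) Ω)
    (hlt : ∀ ζ ∈ sphere (0 : ℂ) 1, (P ζ).re < 0 ∨ ENNReal.ofReal (P ζ).re < g (φ ζ)) :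
    ENNReal.ofReal (P 0).re ≤ g (φ 0) := by
  by_contra! hcon
  obtain ⟨x, hx1, hx2⟩ := ENNReal.lt_iff_exists_nnreal_btwn.1 hcon
  have hxP : (x : ℝ) < (P 0).re := by
    rw [← ENNReal.ofReal_coe_nnreal] at hx2
    exact (ENNReal.ofReal_lt_ofReal_iff_of_nonneg x.2).1 hx2
  set δ : ℝ := (P 0).re - x with hδ
  have hδ0 : 0 < δ := sub_pos.2 hxP
  have hK : IsCompact (closedBall (0 : ℂ) 1) := isCompact_closedBall _ _
  have hpc : ContinuousOn (fun ζ => (P ζ).re) W :=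
    Complex.continuous_re.comp_continuousOn hP.continuousOn
  obtain ⟨M, hM⟩ := hK.exists_bound_of_continuousOn (hpc.mono hKW)
  have hM' : ∀ ζ ∈ closedBall (0 : ℂ) 1, (P ζ).re ≤ M := fun ζ hζ =>
    (le_abs_self _).trans (hM ζ hζ)
  have hM0 : 0 ≤ M := (norm_nonneg _).trans (hM 0 (by simp))
  have hev := (eventually_forall_add_mem hΩ hW hK hKW hφ.continuousOn hφΩ).and
    (eventually_forall_sphere_lt hΩ hg.lsc hW (isCompact_sphere (0 : ℂ) 1)
      (sphere_subset_closedBall.trans hKW) hφ.continuousOn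
      (hφΩ.mono_left sphere_subset_closedBall) hpc hlt)
  obtain ⟨ρ, hρ0, hρ⟩ := Metric.nhds_basis_closedBall.eventually_iff.1 hev
  -- This makes `T ≥ M + 1` where `‖h‖ = ρ`. On `‖ζ‖ = 1` the term `δ - δ * ‖ζ‖ ^ 2` vanishes and
  -- the boundary hypothesis gives a total of at least `M`. At `(0, 0)` the total is below `x + (M -
  -- x) = M`, so the minimum is interior.
  set lam : ℝ := (M + 1) / ρ ^ 2 with hlam
  have hlam0 : 0 < lam := by positivity
  have hlamρ : lam * ρ ^ 2 = M + 1 := by rw [hlam]; field_simp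
  obtain ⟨T, hT⟩ : ∃ T : Cn n × ℂ → ℝ,
      T = fun x => M - (P x.2).re + δ - δ * ‖x.2‖ ^ 2 + lam * ‖x.1‖ ^ 2 := ⟨_, rfl⟩
  have hTnn : ∀ x ∈ closedBall (0 : Cn n) ρ ×ˢ closedBall (0 : ℂ) 1,
      lam * ‖x.1‖ ^ 2 ≤ T x := fun x hx => by
    have h1 := hM' _ hx.2
    have h2 := mem_closedBall_zero_iff.1 hx.2
    have h3 : ‖x.2‖ ^ 2 ≤ 1 := pow_le_one₀ (norm_nonneg _) h2
    simp only [hT]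
    nlinarith
  have hmapsφ : Set.MapsTo (fun x : Cn n × ℂ => φ x.2 + x.1)
      (closedBall 0 ρ ×ˢ closedBall 0 1) Ω := fun x hx => (hρ hx.1).1 _ hx.2
  have hφ2 : ContinuousOn (fun x : Cn n × ℂ => φ x.2) (closedBall 0 ρ ×ˢ closedBall 0 1) :=
    hφ.continuousOn.comp continuousOn_snd fun x hx => hKW hx.2
  have hp2 : ContinuousOn (fun x : Cn n × ℂ => (P x.2).re) (closedBall 0 ρ ×ˢ closedBall 0 1) :=
    hpc.comp continuousOn_snd fun x hx => hKW hx.2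
  have hTc : ContinuousOn T (closedBall 0 ρ ×ˢ closedBall 0 1) := by
    simp only [hT]
    fun_prop
  have hlsc : LowerSemicontinuousOn (fun x : Cn n × ℂ => g (φ x.2 + x.1) + ENNReal.ofReal (T x))
      (closedBall 0 ρ ×ˢ closedBall 0 1) :=
    (hg.lsc.comp (hφ2.add continuousOn_fst) hmapsφ).add
      (ENNReal.continuous_ofReal.comp_continuousOn hTc).lowerSemicontinuousOn
  have h0mem : ((0 : Cn n), (0 : ℂ)) ∈ closedBall (0 : Cn n) ρ ×ˢ closedBall (0 : ℂ) 1 :=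
    ⟨mem_closedBall_self hρ0.le, mem_closedBall_self zero_le_one⟩
  obtain ⟨⟨h₀, ζ₀⟩, hmem₀, hmin⟩ := hlsc.exists_isMinOn ⟨_, h0mem⟩
    ((isCompact_closedBall _ _).prod (isCompact_closedBall _ _))
  have hval : g (φ ζ₀ + h₀) + ENNReal.ofReal (T (h₀, ζ₀)) < ENNReal.ofReal M := by
    refine (isMinOn_iff.1 hmin _ h0mem).trans_lt ?_
    have e1 : T (0, 0) = M - x := by simp [hT, hδ]
    have hxM : (x : ℝ) < M := hxP.trans_le (hM' 0 (by simp))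
    have e2 : ENNReal.ofReal M = x + ENNReal.ofReal (M - x) := by
      rw [← ENNReal.ofReal_coe_nnreal, ← ENNReal.ofReal_add x.coe_nonneg (sub_nonneg.2 hxM.le)]
      congr 1; ring
    simp only [add_zero, e1]
    rw [e2]
    exact ENNReal.add_lt_add_right ENNReal.ofReal_ne_top hx1
  have hT0 : ∀ x ∈ closedBall (0 : Cn n) ρ ×ˢ closedBall (0 : ℂ) 1, 0 ≤ T x := fun x hx =>
    (mul_nonneg hlam0.le (sq_nonneg _)).trans (hTnn x hx)
  have hTM : T (h₀, ζ₀) < M := by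
    have h1 : ENNReal.ofReal (T (h₀, ζ₀)) < ENNReal.ofReal M := lt_of_le_of_lt le_add_self hval
    exact (ENNReal.ofReal_lt_ofReal_iff_of_nonneg (hT0 _ hmem₀)).1 h1
  refine hg.no_penalised_min (hφ.mono (ball_subset_closedBall.trans hKW))
    (hP.mono (ball_subset_closedBall.trans hKW)) hδ0 hlam0 (fun h hh ζ hζ => (hρ hh).1 ζ hζ)
    hT ?_ ?_ ?_ hT0 hmin
  · rw [mem_ball_zero_iff]
    by_contra! hle
    have h1 := hTnn _ hmem₀
    have h2 : lam * ρ ^ 2 ≤ lam * ‖h₀‖ ^ 2 := by gcongr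
    simp only at h1
    linarith
  · rw [mem_ball_zero_iff]
    by_contra! hle
    have hnorm : ‖ζ₀‖ = 1 := le_antisymm (mem_closedBall_zero_iff.1 hmem₀.2) hle
    have hTe : M - (P ζ₀).re ≤ T (h₀, ζ₀) := by
      simp only [hT, hnorm]
      nlinarith [sq_nonneg ‖h₀‖]
    rcases (hρ hmem₀.1).2 ζ₀ (mem_sphere_zero_iff_norm.2 hnorm) with h | h
    · linarith
    · refine lt_irrefl (ENNReal.ofReal M) (lt_of_le_of_lt ?_ hval)
      calc ENNReal.ofReal M = ENNReal.ofReal ((P ζ₀).re + (M - (P ζ₀).re)) := by congr 1; ring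
        _ ≤ ENNReal.ofReal (P ζ₀).re + ENNReal.ofReal (M - (P ζ₀).re) := ENNReal.ofReal_add_le
        _ ≤ g (φ ζ₀ + h₀) + ENNReal.ofReal (T (h₀, ζ₀)) :=
          add_le_add h.le (ENNReal.ofReal_le_ofReal hTe)
  · exact (le_self_add.trans_lt (hval.trans ENNReal.ofReal_lt_top)).ne

/-! ### Uniform lower bounds from a boundary arc -/

/-- The Poisson kernel with pole near `1`, after subtracting a constant: a harmonic function that
is positive at the centre, and on the unit circle negative away from `1`. -/
lemma exists_peak {κ : ℝ} (hκ : 0 < κ) {c : ℝ} (hc : 0 < c) :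
    ∃ (P : ℂ → ℂ) (W : Set ℂ), IsOpen W ∧ closedBall (0 : ℂ) 1 ⊆ W ∧ DifferentiableOn ℂ P W ∧
      0 < (P 0).re ∧ ∀ ζ ∈ sphere (0 : ℂ) 1,
        (P ζ).re < c ∧ (κ ≤ ‖ζ - 1‖ → (P ζ).re < 0) := by
  -- The pole is at `1 / (1 - s)`, outside the closed disc. On the circle the kernel is at most `2 /
  -- s`, whence the scale `η`. Where `‖ζ - 1‖ ≥ κ` the denominator is at least `κ / 2` in norm, and
  -- `32 * s < κ ^ 2` pushes the kernel below `1 / 2`.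
  obtain ⟨s, hs0, hs1, hs2, hs3⟩ : ∃ s : ℝ, 0 < s ∧ s < 1 ∧ s ≤ κ / 2 ∧ 32 * s < κ ^ 2 := by
    refine ⟨min (1 / 2) (min (κ / 2) (κ ^ 2 / 64)), by positivity, ?_, ?_, ?_⟩
    · exact (min_le_left _ _).trans_lt (by norm_num)
    · exact (min_le_right _ _).trans (min_le_left _ _)
    · have := (min_le_right (1 / 2 : ℝ) _).trans (min_le_right (κ / 2) (κ ^ 2 / 64))
      nlinarith [sq_pos_of_pos hκ]
  set t : ℝ := 1 - s with ht
  have ht0 : 0 < t := by linarith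
  have ht1 : t < 1 := by linarith
  set η : ℝ := c * s / 4 with hη
  have hη0 : 0 < η := by positivity
  have hne : ∀ ζ ∈ ball (0 : ℂ) t⁻¹, (1 : ℂ) - t * ζ ≠ 0 := fun ζ hζ h => by
    rw [mem_ball_zero_iff] at hζ
    have h1 : (t : ℂ) * ζ = 1 := (sub_eq_zero.1 h).symm
    have h2 : t * ‖ζ‖ = 1 := by
      have := congrArg norm h1
      simpa [abs_of_pos ht0] using this
    have h3 : t * ‖ζ‖ < t * t⁻¹ := by gcongr
    rw [mul_inv_cancel₀ ht0.ne'] at h3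
    linarith
  refine ⟨fun ζ => (η : ℂ) * ((1 + t * ζ) / (1 - t * ζ) - (1 / 2 : ℝ)), ball 0 t⁻¹, isOpen_ball,
    closedBall_subset_ball ((one_lt_inv₀ ht0).2 ht1), ?_, ?_, ?_⟩
  · exact DifferentiableOn.const_mul ((DifferentiableOn.div (by fun_prop) (by fun_prop) hne).sub
      (by fun_prop)) _
  · rw [Complex.re_ofReal_mul]
    have : (0 : ℝ) < η * (1 / 2) := by positivity
    norm_num
    linarith
  · intro ζ hζ
    rw [mem_sphere_zero_iff_norm] at hζ
    have hre : ((1 + t * ζ) / (1 - t * ζ)).re = (1 - t ^ 2) / ‖1 - t * ζ‖ ^ 2 := by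
      have hζ2 : ζ.re * ζ.re + ζ.im * ζ.im = 1 := by
        have := Complex.sq_norm ζ
        rw [hζ, Complex.normSq_apply] at this
        linarith
      rw [Complex.div_re, ← add_div, ← Complex.sq_norm]
      congr 1
      simp
      linear_combination (-t ^ 2) * hζ2
    have hlow : s ≤ ‖1 - t * ζ‖ := by
      have := norm_sub_norm_le (1 : ℂ) (t * ζ)
      simp [abs_of_pos ht0, hζ] at this
      linarith
    have hnum : 1 - t ^ 2 ≤ 2 * s := by rw [ht]; nlinarith
    have hnum0 : 0 ≤ 1 - t ^ 2 := by nlinarith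
    have hval : ((η : ℂ) * ((1 + t * ζ) / (1 - t * ζ) - (1 / 2 : ℝ))).re =
        η * ((1 - t ^ 2) / ‖1 - t * ζ‖ ^ 2 - 1 / 2) := by
      rw [Complex.re_ofReal_mul, Complex.sub_re, hre, Complex.ofReal_re]
    rw [hval]
    constructor
    · have h1 : (1 - t ^ 2) / ‖1 - t * ζ‖ ^ 2 ≤ 2 * s / s ^ 2 := by gcongr
      have h2 : 2 * s / s ^ 2 = 2 / s := by field_simp
      have h3 : η * (2 / s) = c / 2 := by rw [hη]; field_simp; norm_num
      nlinarith
    · intro hκζ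
      have h1 : κ / 2 ≤ ‖1 - t * ζ‖ := by
        have h2 : ζ - 1 = -(1 - t * ζ) + s * ζ := by rw [ht]; push_cast; ring
        have h3 := norm_add_le (-(1 - t * ζ)) (s * ζ)
        rw [← h2, norm_neg] at h3
        simp only [norm_mul, Complex.norm_real, Real.norm_eq_abs, abs_of_pos hs0, hζ, mul_one] at h3
        linarith
      have h4 : (1 - t ^ 2) / ‖1 - t * ζ‖ ^ 2 ≤ 2 * s / (κ / 2) ^ 2 := by gcongr
      have h5 : 2 * s / (κ / 2) ^ 2 < 1 / 2 := by
        rw [div_lt_iff₀ (by positivity)]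
        nlinarith
      exact mul_neg_of_pos_of_neg hη0 (by linarith)

/-- If a plurisuperharmonic function is at least `c` along analytic discs on a fixed arc of the
boundary circle, then it is bounded below at the centres, uniformly in the discs. -/
lemma PlurisuperharmonicOn.exists_lower_bound {n : ℕ} {g : Cn n → ℝ≥0∞} {Ω : Set (Cn n)}
    (hΩ : IsOpen Ω) (hg : PlurisuperharmonicOn g Ω) {κ : ℝ} (hκ : 0 < κ) {c : ℝ≥0∞} (hc : 0 < c) :
    ∃ η : ℝ≥0∞, 0 < η ∧ ∀ (φ : ℂ → Cn n) (W : Set ℂ), IsOpen W → closedBall (0 : ℂ) 1 ⊆ W →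
      DifferentiableOn ℂ φ W → Set.MapsTo φ (closedBall 0 1) Ω →
      (∀ ζ ∈ sphere (0 : ℂ) 1, ‖ζ - 1‖ < κ → c < g (φ ζ)) → η ≤ g (φ 0) := by
  obtain ⟨c', hc'0, hc'⟩ := ENNReal.lt_iff_exists_nnreal_btwn.1 hc
  have hc'0 : (0 : ℝ) < c' := by exact_mod_cast hc'0
  obtain ⟨P, W', hW', hKW', hP, hP0, hPs⟩ := exists_peak hκ hc'0
  refine ⟨ENNReal.ofReal (P 0).re, ENNReal.ofReal_pos.2 hP0, fun φ W hW hKW hφ hφΩ hbd => ?_⟩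
  refine hg.le_of_lt_on_sphere hΩ (hW.inter hW') (Set.subset_inter hKW hKW')
    (hφ.mono Set.inter_subset_left) (hP.mono Set.inter_subset_right) hφΩ fun ζ hζ => ?_
  rcases lt_or_ge ‖ζ - 1‖ κ with h | h
  · right
    refine lt_of_le_of_lt ?_ (hbd ζ hζ h)
    refine le_trans ?_ hc'.le
    rw [← ENNReal.ofReal_coe_nnreal]
    exact ENNReal.ofReal_le_ofReal (hPs ζ hζ).1.le
  · exact Or.inl ((hPs ζ hζ).2 h)

/-! ### Normal families and limit discs -/

/-- Cauchy's estimate on circles of radius `(1 - R) / 2`; the constant depends only on `M` and `R`,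
which gives equicontinuity. -/
lemma dist_le_of_bounded_on_disc {n : ℕ} {φ : ℂ → Cn n} (hφ : DifferentiableOn ℂ φ disc) {M R : ℝ}
    (hM : ∀ ζ ∈ disc, ‖φ ζ‖ ≤ M) (hR : R < 1) {x y : ℂ} (hx : x ∈ closedBall (0 : ℂ) R)
    (hy : y ∈ closedBall (0 : ℂ) R) : dist (φ x) (φ y) ≤ M / ((1 - R) / 2) * dist x y := by
  rw [dist_eq_norm, dist_eq_norm]
  have hsub : ∀ z ∈ closedBall (0 : ℂ) R, closedBall z ((1 - R) / 2) ⊆ disc := fun z hz =>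
    closedBall_subset_ball' (by rw [mem_closedBall] at hz; linarith)
  refine (convex_closedBall (0 : ℂ) R).norm_image_sub_le_of_norm_deriv_le (𝕜 := ℂ)
    (fun z hz => ?_) (fun z hz => ?_) hy hx
  · exact hφ.differentiableAt (isOpen_ball.mem_nhds
      (hsub z hz (mem_closedBall_self (by linarith))))
  · refine Complex.norm_deriv_le_of_forall_mem_sphere_norm_le (by linarith) ?_
      fun w hw => hM w (hsub z hz (sphere_subset_closedBall hw))
    refine ⟨hφ.mono (ball_subset_closedBall.trans (hsub z hz)), ?_⟩
    rw [closure_ball _ (by linarith)]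
    exact hφ.continuousOn.mono (hsub z hz)

/-- Montel's theorem for bounded sequences of discs, with limits along an ultrafilter. -/
lemma exists_tendsto_of_bounded_discs {n : ℕ} {ι : Type*} (𝒰 : Ultrafilter ι)
    {φ : ι → ℂ → Cn n} (hφ : ∀ i, DifferentiableOn ℂ (φ i) disc) {M : ℝ}
    (hM : ∀ i, ∀ ζ ∈ disc, ‖φ i ζ‖ ≤ M) :
    ∃ ψ : ℂ → Cn n, DifferentiableOn ℂ ψ disc ∧
      ∀ ζ ∈ disc, Tendsto (fun i => φ i ζ) 𝒰 (𝓝 (ψ ζ)) := by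
  have hlim : ∀ ζ : ℂ, ∃ y : Cn n, ζ ∈ disc → Tendsto (fun i => φ i ζ) 𝒰 (𝓝 y) := fun ζ => by
    by_cases hζ : ζ ∈ disc
    · obtain ⟨y, -, hy⟩ := (isCompact_closedBall (0 : Cn n) M).ultrafilter_le_nhds
        (𝒰.map fun i => φ i ζ) (by
          rw [le_principal_iff]
          exact mem_map.2 (univ_mem' fun i => mem_closedBall_zero_iff.2 (hM i ζ hζ)))
      exact ⟨y, fun _ => hy⟩
    · exact ⟨0, fun h => absurd h hζ⟩
  choose ψ hψ using hlim
  refine ⟨ψ, ?_, hψ⟩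
  have hloc : TendstoLocallyUniformlyOn φ ψ 𝒰 disc := by
    rw [Metric.tendstoLocallyUniformlyOn_iff]
    intro ε hε x hx
    obtain ⟨R, hxR, hR⟩ := exists_between (mem_ball_zero_iff.1 hx)
    set L := M / ((1 - R) / 2) with hL
    have hM0 : 0 ≤ M := by
      obtain ⟨i, -⟩ := 𝒰.neBot.nonempty_of_mem (univ_mem)
      exact (norm_nonneg _).trans (hM i x hx)
    have hL0 : 0 ≤ L := div_nonneg hM0 (by linarith)
    have hlip : ∀ i, ∀ y ∈ ball (0 : ℂ) R, dist (φ i y) (φ i x) ≤ L * dist y x := fun i y hy =>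
      dist_le_of_bounded_on_disc (hφ i) (hM i) hR (ball_subset_closedBall hy)
        (mem_closedBall_zero_iff.2 hxR.le)
    have hlip' : ∀ y ∈ ball (0 : ℂ) R, dist (ψ y) (ψ x) ≤ L * dist y x := fun y hy =>
      le_of_tendsto ((hψ y (ball_subset_ball hR.le hy)).dist (hψ x hx))
        (Eventually.of_forall fun i => hlip i y hy)
    refine ⟨ball 0 R ∩ ball x (ε / (3 * (L + 1))), mem_nhdsWithin_of_mem_nhds
      (inter_mem (isOpen_ball.mem_nhds (mem_ball_zero_iff.2 hxR))
        (ball_mem_nhds _ (by positivity))), ?_⟩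
    filter_upwards [(hψ x hx).eventually (ball_mem_nhds (ψ x) (by positivity : 0 < ε / 3))]
      with i hi y hy
    have h1 : L * dist y x ≤ ε / 3 := by
      have h2 : dist y x ≤ ε / (3 * (L + 1)) := (mem_ball.1 hy.2).le
      calc L * dist y x ≤ (L + 1) * (ε / (3 * (L + 1))) := by gcongr; linarith
        _ = ε / 3 := by field_simp
    have h3 := hlip i y hy.1
    have h4 := hlip' y hy.1
    have h5 := dist_triangle4 (ψ y) (ψ x) (φ i x) (φ i y)
    rw [dist_comm] at hi
    rw [dist_comm (φ i y)] at h3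
    linarith
  exact hloc.differentiableOn (Eventually.of_forall hφ) isOpen_ball

/-- Limits of discs in `D` whose values approach a boundary point `b` with a weak barrier lie
locally in the boundary. -/
lemma limit_disc_mem_frontier {n : ℕ} {D U : Set (Cn n)} (hD : IsOpen D) (hU : IsOpen U)
    {b : Cn n} (hbU : b ∈ U) {g : Cn n → ℝ≥0∞} (hg : PlurisuperharmonicOn g (D ∩ U))
    (hpos : ∀ z ∈ D ∩ U, 0 < g z) (hlim : Tendsto g (𝓝[D ∩ U] b) (𝓝 0))
    {ι : Type*} {l : Filter ι} [l.NeBot] {φ : ι → ℂ → Cn n} (hφ : ∀ i, IsDiscIn (φ i) D) {M : ℝ}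
    (hM : ∀ i, ∀ ζ ∈ disc, ‖φ i ζ‖ ≤ M) {ψ : ℂ → Cn n}
    (hψ : ∀ ζ ∈ disc, Tendsto (fun i => φ i ζ) l (𝓝 (ψ ζ))) {α : ι → ℂ} {a : ℂ}
    (hα : Tendsto α l (𝓝 a)) (ha : a ∈ disc) (hb : Tendsto (fun i => φ i (α i)) l (𝓝 b)) :
    ψ a = b ∧ ∃ ρ > 0, ball a ρ ⊆ disc ∧ ∀ ζ ∈ ball a ρ, ψ ζ ∈ frontier D := by
  have ha' : ‖a‖ < 1 := mem_ball_zero_iff.1 ha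
  set s : ℝ := (1 - ‖a‖) / 4 with hs
  have hs0 : 0 < s := by rw [hs]; linarith
  set R : ℝ := ‖a‖ + 2 * s with hR
  have hR1 : R < 1 := by rw [hR, hs]; linarith
  set L := M / ((1 - R) / 2) with hL
  have hM0 : 0 ≤ M := by
    obtain ⟨i, -⟩ := ‹l.NeBot›.nonempty_of_mem univ_mem
    exact (norm_nonneg _).trans (hM i a ha)
  have hL0 : 0 ≤ L := div_nonneg hM0 (by linarith)
  have hlip : ∀ i, ∀ x ∈ closedBall (0 : ℂ) R, ∀ y ∈ closedBall (0 : ℂ) R,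
      dist (φ i x) (φ i y) ≤ L * dist x y := fun i x hx y hy =>
    dist_le_of_bounded_on_disc (hφ i).1 (hM i) hR1 hx hy
  have hαs : ∀ᶠ i in l, ‖α i - a‖ < s := by
    filter_upwards [hα.eventually (ball_mem_nhds a hs0)] with i hi
    rwa [dist_eq_norm] at hi
  have hinR : ∀ x y : ℂ, ‖x - a‖ < s → ‖y‖ ≤ s → x + y ∈ closedBall (0 : ℂ) R :=
    fun x y hx hy => by
      rw [mem_closedBall_zero_iff]
      have h1 : x + y = a + (x - a) + y := by ring
      have h2 := norm_add₃_le (a := a) (b := x - a) (c := y)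
      rw [h1]
      linarith
  -- Recentring at `α i`, where the values tend to `b`, costs nothing in the limit by the common
  -- Lipschitz constant.
  have hmove : ∀ v : ℂ, ‖v‖ ≤ s → Tendsto (fun i => φ i (α i + v)) l (𝓝 (ψ (a + v))) := by
    intro v hv
    have hav : a + v ∈ closedBall (0 : ℂ) R := hinR a v (by simpa using hs0) hv
    have h1 := hψ (a + v) (closedBall_subset_ball hR1 hav)
    refine h1.congr_dist ?_
    refine squeeze_zero' (g := fun i => L * dist a (α i)) (Eventually.of_forall fun i => dist_nonneg)
      ?_ ?_
    · filter_upwards [hαs] with i hi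
      have := hlip i _ hav _ (hinR (α i) v hi hv)
      rwa [dist_add_right] at this
    · have := (tendsto_const_nhds (x := a)).dist hα
      rw [dist_self] at this
      simpa using this.const_mul L
  have hab : ψ a = b := by
    have h1 := hmove 0 (by simpa using hs0.le)
    simp only [add_zero] at h1
    exact tendsto_nhds_unique h1 hb
  refine ⟨hab, ?_⟩
  obtain ⟨ε, hε, hεU⟩ := Metric.nhds_basis_closedBall.mem_iff.1 (hU.mem_nhds hbU)
  obtain ⟨ρ, hρ0, hρs, hρε⟩ : ∃ ρ > 0, ρ ≤ s ∧ L * ρ ≤ ε / 2 := by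
    refine ⟨min s (ε / (2 * (L + 1))), by positivity, min_le_left _ _, ?_⟩
    calc L * min s (ε / (2 * (L + 1))) ≤ (L + 1) * (ε / (2 * (L + 1))) := by
          gcongr
          · linarith
          · exact min_le_right _ _
      _ = ε / 2 := by field_simp
  refine ⟨ρ, hρ0, fun ζ hζ => ?_, fun ζ₁ hζ₁ => ?_⟩
  · rw [mem_ball, dist_eq_norm] at hζ
    have := hinR ζ 0 (hζ.trans_le hρs) (by simpa using hs0.le)
    rw [add_zero] at this
    exact closedBall_subset_ball hR1 this
  set v : ℂ := ζ₁ - a with hv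
  have hvρ : ‖v‖ ≤ ρ := by rw [mem_ball, dist_eq_norm] at hζ₁; exact hζ₁.le
  have hav : a + v = ζ₁ := by rw [hv]; ring
  have hvζ : ∀ ζ ∈ closedBall (0 : ℂ) 1, ‖v * ζ‖ ≤ s := fun ζ hζ => by
    rw [norm_mul]
    rw [mem_closedBall_zero_iff] at hζ
    nlinarith [norm_nonneg v, norm_nonneg ζ]
  have hψ₁ : Tendsto (fun i => φ i (α i + v)) l (𝓝 (ψ ζ₁)) := by
    have := hmove v (hvρ.trans hρs)
    rwa [hav] at this
  have hnear : ∀ᶠ i in l, ∀ ζ ∈ closedBall (0 : ℂ) 1, φ i (α i + v * ζ) ∈ closedBall b ε := by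
    filter_upwards [hαs, hb.eventually (ball_mem_nhds b (half_pos hε))] with i hi hbi ζ hζ
    have h1 := hlip i _ (hinR _ _ hi (hvζ ζ hζ)) _ (hinR (α i) 0 hi (by simpa using hs0.le))
    have h2 : dist (α i + v * ζ) (α i + 0) ≤ ρ := by
      rw [dist_add_left, dist_zero_right, norm_mul]
      rw [mem_closedBall_zero_iff] at hζ
      nlinarith [norm_nonneg v, norm_nonneg ζ]
    have h3 : L * dist (α i + v * ζ) (α i + 0) ≤ L * ρ := by gcongr
    rw [add_zero] at h1 h3
    rw [mem_closedBall]
    linarith [dist_triangle (φ i (α i + v * ζ)) (φ i (α i)) b]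
  rw [hD.frontier_eq]
  have hdisc : ∀ᶠ i in l, ∀ ζ ∈ closedBall (0 : ℂ) 1, α i + v * ζ ∈ disc := by
    filter_upwards [hαs] with i hi ζ hζ
    exact closedBall_subset_ball hR1 (hinR _ _ hi (hvζ ζ hζ))
  have h1mem : (1 : ℂ) ∈ closedBall (0 : ℂ) 1 := by simp
  have h0mem : (0 : ℂ) ∈ closedBall (0 : ℂ) 1 := by simp
  refine ⟨mem_closure_of_tendsto hψ₁ ?_, fun hmemD => ?_⟩
  · filter_upwards [hdisc] with i hi
    have := hi 1 h1mem
    rw [mul_one] at this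
    exact (hφ i).2 this
  have hΩ : IsOpen (D ∩ U) := hD.inter hU
  have hψU : ψ ζ₁ ∈ D ∩ U := by
    refine ⟨hmemD, hεU (isClosed_closedBall.mem_of_tendsto hψ₁ ?_)⟩
    filter_upwards [hnear] with i hi
    simpa using hi 1 h1mem
  obtain ⟨c, hc0, hc⟩ := exists_between (hpos _ hψU)
  have hgc : ∀ᶠ z in 𝓝 (ψ ζ₁), c < g z := by
    have := hg.lsc _ hψU c hc
    rwa [hΩ.nhdsWithin_eq hψU] at this
  obtain ⟨σ, hσ, hσg⟩ := Metric.eventually_nhds_iff_ball.1 hgc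
  -- In the parametrisation `ζ ↦ α i + v * ζ` the point `ζ = 1` is sent near `ζ₁`. An arc of size
  -- `κ` about it moves `φ i` by at most `σ / 2`, independently of `i`.
  set κ : ℝ := σ / (2 * (L * ρ + 1)) with hκ
  have hLρ : 0 ≤ L * ρ := by positivity
  have hκ0 : 0 < κ := by positivity
  have hκσ : L * ρ * κ ≤ σ / 2 := by
    calc L * ρ * κ ≤ (L * ρ + 1) * κ := by gcongr; linarith
      _ = σ / 2 := by rw [hκ]; field_simp
  obtain ⟨η, hη, hηg⟩ := hg.exists_lower_bound hΩ hκ0 hc0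
  have hge : ∀ᶠ i in l, η ≤ g (φ i (α i)) := by
    filter_upwards [hαs, hnear, hdisc, hψ₁.eventually (ball_mem_nhds (ψ ζ₁) (half_pos hσ))]
      with i hi hni hdi hσi
    have h := hηg (fun ζ => φ i (α i + v * ζ)) ((fun ζ => α i + v * ζ) ⁻¹' disc)
      (isOpen_ball.preimage (by fun_prop)) hdi
      ((hφ i).1.comp (by fun_prop) (Set.mapsTo_preimage _ _))
      (fun ζ hζ => ⟨(hφ i).2 (hdi ζ hζ), hεU (hni ζ hζ)⟩) fun ζ hζ hζκ => ?_
    · simpa using h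
    · apply hσg
      have hζ' := sphere_subset_closedBall hζ
      have h1 := hlip i _ (hinR _ _ hi (hvζ ζ hζ')) _ (hinR _ _ hi (hvζ 1 h1mem))
      have h2 : dist (α i + v * ζ) (α i + v * 1) ≤ ρ * κ := by
        rw [dist_add_left, dist_eq_norm, ← mul_sub, norm_mul]
        gcongr
      have h3 : L * dist (α i + v * ζ) (α i + v * 1) ≤ L * (ρ * κ) := by gcongr
      rw [← mul_assoc] at h3
      rw [mul_one] at h1 h3
      rw [mem_ball]
      linarith [dist_triangle (φ i (α i + v * ζ)) (φ i (α i + v)) (ψ ζ₁)]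
  have hwithin : Tendsto (fun i => φ i (α i)) l (𝓝[D ∩ U] b) := by
    refine tendsto_nhdsWithin_iff.2 ⟨hb, ?_⟩
    filter_upwards [hnear, hdisc] with i hni hdi
    have h1 := hni 0 h0mem
    have h2 := hdi 0 h0mem
    rw [mul_zero, add_zero] at h1 h2
    exact ⟨(hφ i).2 h2, hεU h1⟩
  obtain ⟨i, hi1, hi2⟩ := (hge.and ((hlim.comp hwithin).eventually (gt_mem_nhds hη))).exists
  exact absurd hi1 (not_le.2 hi2)

/-! ### Lempert functions and chains near the barrier point -/

lemma exists_disc_of_lempert_lt {n : ℕ} {D : Set (Cn n)} {z w : Cn n} {C : ℝ≥0∞}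
    (h : lempert D z w < C) (hC : C ≠ ⊤) :
    ∃ α ∈ closedBall (0 : ℂ) (Real.tanh C.toReal), ∃ φ : ℂ → Cn n,
      IsDiscIn φ D ∧ φ 0 = z ∧ φ α = w := by
  simp only [lempert, iInf_lt_iff] at h
  obtain ⟨α, hα, ⟨φ, hφ⟩, hlt⟩ := h
  refine ⟨α, ?_, φ, hφ⟩
  rw [mem_closedBall_zero_iff]
  rw [mem_ball_zero_iff] at hα
  have hmem : ‖α‖ ∈ Set.Ioo (-1 : ℝ) 1 := ⟨by linarith [norm_nonneg α], hα⟩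
  have h1 : Real.artanh ‖α‖ ≤ C.toReal := (ENNReal.ofReal_le_iff_le_toReal hC).1 hlt.le
  rw [← Real.artanh_tanh C.toReal] at h1
  exact (Real.artanh_le_artanh_iff hmem ⟨Real.neg_one_lt_tanh _, Real.tanh_lt_one _⟩).1 h1

/-- Localisation at a barrier point: points at bounded Lempert distance from a point near `b` are
themselves near `b`. -/
lemma eventually_mem_of_lempert_lt {n : ℕ} {D : Set (Cn n)} (hD : IsOpen D)
    (hbdd : Bornology.IsBounded D) {b : Cn n} (hb : IsLocalWeakBarrierPoint D b)
    (hdisc : ¬ HasNontrivialDiscThrough (frontier D) b) {C : ℝ≥0∞} (hC : C ≠ ⊤)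
    {V : Set (Cn n)} (hV : V ∈ 𝓝 b) :
    ∀ᶠ w in 𝓝[D] b, ∀ p, lempert D p w < C → p ∈ V := by
  obtain ⟨-, U, hU, hbU, u, hu, hneg, hlim⟩ := hb
  by_contra hcon
  obtain ⟨w, hw, hfreq⟩ := exists_seq_forall_of_frequently (not_eventually.1 hcon)
  push Not at hfreq
  choose p hp hpV using hfreq
  choose α hα φ hφ hφ0 hφα using fun k => exists_disc_of_lempert_lt (hp k) hC
  obtain ⟨M, hM⟩ := hbdd.exists_norm_le
  have hM' : ∀ k, ∀ ζ ∈ disc, ‖φ k ζ‖ ≤ M := fun k ζ hζ => hM _ ((hφ k).2 hζ)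
  let 𝒰 : Ultrafilter ℕ := Ultrafilter.of atTop
  have h𝒰 : (𝒰 : Filter ℕ) ≤ atTop := Ultrafilter.of_le atTop
  obtain ⟨ψ, hψd, hψ⟩ := exists_tendsto_of_bounded_discs 𝒰 (fun k => (hφ k).1) hM'
  obtain ⟨a, ha, haα⟩ := (isCompact_closedBall (0 : ℂ) (Real.tanh C.toReal)).ultrafilter_le_nhds
    (𝒰.map α) (by
      rw [le_principal_iff]
      exact mem_map.2 (univ_mem' hα))
  have ha' : a ∈ disc := closedBall_subset_ball (Real.tanh_lt_one _) ha
  have hwb : Tendsto (fun k => φ k (α k)) 𝒰 (𝓝 b) := by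
    simp only [hφα]
    exact (tendsto_nhds_of_tendsto_nhdsWithin hw).mono_left h𝒰
  have hglim : Tendsto (fun z => (-(u z)).toENNReal) (𝓝[D ∩ U] b) (𝓝 0) := by
    have h1 := (EReal.continuous_toENNReal.tendsto _).comp ((continuous_neg.tendsto _).comp hlim)
    simpa [Function.comp_def] using h1
  obtain ⟨hab, ρ, hρ, hρd, hρf⟩ := limit_disc_mem_frontier hD hU hbU (hu.neg hneg)
    (fun z hz => by
      have := hneg z hz
      exact EReal.toENNReal_pos_iff.2 (by rwa [EReal.lt_neg_comm, neg_zero]))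
    hglim hφ hM' hψ haα ha' hwb
  have hmaps : Set.MapsTo (fun ζ : ℂ => a + ρ * ζ) disc (ball a ρ) := fun ζ hζ => by
    rw [mem_ball_zero_iff] at hζ
    rw [mem_ball, dist_eq_norm, add_sub_cancel_left, norm_mul, Complex.norm_real, Real.norm_eq_abs,
      abs_of_pos hρ]
    nlinarith
  have hconst : ∀ ζ ∈ ball a ρ, ψ ζ = b := by
    by_contra! hne
    obtain ⟨ζ, hζ, hζb⟩ := hne
    refine hdisc ⟨fun ζ => ψ (a + ρ * ζ), ⟨hψd.comp (by fun_prop) (hmaps.mono_right hρd),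
      fun ζ hζ => hρf _ (hmaps hζ)⟩, ⟨0, by simp, by simpa using hab⟩, (ζ - a) / ρ, ?_, ?_⟩
    · rw [mem_ball_zero_iff, norm_div, Complex.norm_real, Real.norm_eq_abs, abs_of_pos hρ,
        div_lt_one hρ]
      rwa [mem_ball, dist_eq_norm] at hζ
    · have hρ' : (ρ : ℂ) ≠ 0 := by exact_mod_cast hρ.ne'
      have : a + ρ * ((ζ - a) / ρ) = ζ := by field_simp; ring
      simpa only [this] using hζb
  -- The identity theorem carries constancy from near `a` to the centre `0`, where the limit of the
  -- `p k` is read off.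
  have hψb : Set.EqOn ψ (fun _ => b) disc := by
    refine (hψd.analyticOnNhd isOpen_ball).eqOn_of_preconnected_of_eventuallyEq
      analyticOnNhd_const (convex_ball _ _).isPreconnected ha' ?_
    filter_upwards [ball_mem_nhds a hρ] with ζ hζ using hconst ζ hζ
  have h0 : Tendsto p 𝒰 (𝓝 b) := by
    have h1 := hψ 0 (by simp)
    rw [hψb (by simp : (0 : ℂ) ∈ disc)] at h1
    simpa only [hφ0] using h1
  obtain ⟨k, hk⟩ := (h0.eventually hV).exists
  exact hpV k hk

/-- Peel off the last link: the points from which shorter chains are controlled fill a neighbourhood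
of `b` within `D`, and localisation for one link puts the penultimate point there. -/
lemma eventually_mem_of_chain_lt {n : ℕ} {D : Set (Cn n)} (hD : IsOpen D)
    (hbdd : Bornology.IsBounded D) {b : Cn n} (hb : IsLocalWeakBarrierPoint D b)
    (hdisc : ¬ HasNontrivialDiscThrough (frontier D) b) {C : ℝ≥0∞} (hC : C ≠ ⊤) (m : ℕ)
    {V : Set (Cn n)} (hV : V ∈ 𝓝 b) :
    ∀ᶠ w in 𝓝[D] b, ∀ p : Fin (m + 1) → Cn n, (∀ j, p j ∈ D) → p (Fin.last m) = w →
      ∑ j : Fin m, lempert D (p j.castSucc) (p j.succ) < C → p 0 ∈ V := by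
  induction m with
  | zero =>
    filter_upwards [mem_nhdsWithin_of_mem_nhds hV] with w hw p hpD hpw _
    rwa [← hpw] at hw
  | succ m ih =>
    rw [eventually_nhdsWithin_iff] at ih
    filter_upwards [eventually_mem_of_lempert_lt hD hbdd hb hdisc hC ih] with w hw p hpD hpw hsum
    rw [Fin.sum_univ_castSucc] at hsum
    have hlast : lempert D (p (Fin.last m).castSucc) w < C := by
      rw [← hpw]
      exact lt_of_le_of_lt le_add_self hsum
    exact hw _ hlast (hpD _) (fun j => p j.castSucc) (fun j => hpD _) rfl
      (lt_of_le_of_lt le_self_add hsum)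

end LempertFn

theorem proposition8 {n : ℕ} (D : Set (LempertFn.Cn n)) (hD : LempertFn.IsDomainOf D)
    (hbdd : Bornology.IsBounded D) (b : LempertFn.Cn n)
    (hb : LempertFn.IsLocalWeakBarrierPoint D b)
    (hdisc : ¬ LempertFn.HasNontrivialDiscThrough (frontier D) b)
    (z : LempertFn.Cn n) (hz : z ∈ D) (m : ℕ) :
    Tendsto (fun w => LempertFn.lempertChain D m z w) (𝓝[D] b) (𝓝 (⊤ : ℝ≥0∞)) := by
  have hzb : b ≠ z := fun h => by
    have := hb.1
    rw [hD.1.frontier_eq] at this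
    exact this.2 (h ▸ hz)
  rw [ENNReal.tendsto_nhds_top_iff_nnreal]
  intro C
  have hV : ({z}ᶜ : Set (LempertFn.Cn n)) ∈ 𝓝 b := isOpen_compl_singleton.mem_nhds hzb
  filter_upwards [LempertFn.eventually_mem_of_chain_lt hD.1 hbdd hb hdisc
    (ENNReal.coe_ne_top (r := C + 1)) m hV] with w hw
  refine lt_of_lt_of_le (b := ((C + 1 : NNReal) : ℝ≥0∞)) (by exact_mod_cast lt_add_one C) ?_
  simp only [LempertFn.lempertChain, le_iInf_iff]
  intro p hpD hp0 hpw
  by_contra! hlt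
  exact hw p hpD hpw hlt hp0
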